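/- Assume the Continuum Hypothesis and write $\mathfrak c=2^{\aleph_0}$. For a locally compact Hausdorff space $W$, a homeomorphism $\varphi$ of $\beta W\setminus W$ onto itself is called \emph{trivial} if there are compact sets $K_1,K_2\subseteq W$ and a homeomorphism $f\colon W\setminus K_1\to W\setminus K_2$ such that $\varphi$ is the restriction to $\beta W\setminus W$ of the unique continuous extension of $f$ to a map $\beta W\setminus K_1\to\beta W$. Let $X$ be a noncompact, metrizable, second countable topological manifold (without boundary, hence locally compact) of dimension $n\ge 1$. Then: (1) $\beta X\setminus X$ has exactly $2^{\mathfrak c}$ homeomorphisms, and exactly $2^{\mathfrak c}$ of them are nontrivial. (2) If $Y$ is a locally compact Hausdorff space that has a compact connected component, then $\beta(X\times Y)\setminus(X\times Y)$ has at least $2^{\mathfrak c}$ nontrivial homeomorphisms. If moreover $Y$ is second countable, then $\beta(X\times Y)\setminus(X\times Y)$ has exactly $2^{\mathfrak c}$ homeomorphisms, and exactly $2^{\mathfrak c}$ of them are nontrivial. -/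

import Mathlib

universe u v

/-- The Čech–Stone remainder `βX ∖ X`, with the subspace topology of `βX`. -/
abbrev StoneCechRemainder (X : Type u) [TopologicalSpace X] : Type u :=
  ↥((Set.range (stoneCechUnit : X → StoneCech X))ᶜ)

/-- A homeomorphism `φ` of `βX ∖ X` is trivial if there are compact sets `K₁, K₂ ⊆ X` and a
homeomorphism `f : X ∖ K₁ → X ∖ K₂` such that `φ` is the restriction to `βX ∖ X` of the continuous
extension of `f` to `βX ∖ K₁`. For the locally compact Hausdorff spaces considered here this
extension `F` exists, and it is unique because `X ∖ K₁` is dense in `βX ∖ K₁`; the values of `F` on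
`K₁` are irrelevant. -/
def IsTrivialRemainderHomeo {X : Type u} [TopologicalSpace X]
    (φ : StoneCechRemainder X ≃ₜ StoneCechRemainder X) : Prop :=
  ∃ (K₁ K₂ : Set X) (f : ↥(K₁ᶜ) ≃ₜ ↥(K₂ᶜ)) (F : StoneCech X → StoneCech X),
    IsCompact K₁ ∧ IsCompact K₂ ∧
    ContinuousOn F ((stoneCechUnit '' K₁)ᶜ) ∧
    (∀ x : ↥(K₁ᶜ), F (stoneCechUnit (x : X)) = stoneCechUnit (f x : X)) ∧
    ∀ p : StoneCechRemainder X, F (p : StoneCech X) = (φ p : StoneCech X)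

/-! Fix a locally finite sequence of disjoint balls in `X`, times a compact open piece `K` of `Y` (a
point when there is no `Y`). Given small vectors `τ k`, `twist` pushes the centre of the `k`-th ball
to `τ k` and so induces a homeomorphism of the remainder. A continuous function on `βZ` has a
modulus of continuity on each ball, so it cannot distinguish on the remainder two twists whose
vectors differ by less than these moduli.

Under CH the moduli are dominated along a scale `f` of length `ω₁` (`exists_scale`), and there is a
binary tree of sequences of vectors in which, past level `j`, a branch moves only by `o(1 / f j)`,
while two branches differ by exactly `1 / f i` at the first level `i` where they part
(`exists_tower`). Along a branch every continuous function stabilises, so the twists converge to a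
homeomorphism of the remainder (`exists_limit_twist`). A bump of slope `f i` tells distinct branches
apart at a limit `p` of the centres (`exists_separating`). This gives `2 ^ 𝔠` homeomorphisms.

A trivial homeomorphism is, as far as these bumps at `p` can see, coded by one sequence in `Option
(ℕ × E)` (`exists_code_of_isTrivialRemainderHomeo`). There are at most `𝔠` codes, so `2 ^ 𝔠`
branches are nontrivial. The upper bound holds because a second countable space has at most `𝔠`
continuous functions on its compactification (`mk_remainderHomeo_le`). -/

section StoneCechRemainders

open Set Filter Topology

/-! ### The remainder and the homeomorphisms of it induced from the space. -/

section StoneCechBasics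

variable {Z : Type u} [TopologicalSpace Z]

theorem t35Space_of_locallyCompactSpace [T2Space Z] [LocallyCompactSpace Z] : T35Space Z :=
  OnePoint.isOpenEmbedding_coe.isEmbedding.t35Space

/-- By density, an open set of `βZ` whose trace on `Z` lies in a compact `C` is contained in the
closure of the image of `C`, which is that image itself. -/
theorem isOpen_range_stoneCechUnit [T2Space Z] [LocallyCompactSpace Z] :
    IsOpen (range (stoneCechUnit : Z → StoneCech Z)) := by
  have := t35Space_of_locallyCompactSpace (Z := Z)
  rw [isOpen_iff_mem_nhds]
  rintro _ ⟨z, rfl⟩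
  obtain ⟨C, hC, hz⟩ := exists_compact_mem_nhds z
  have hz' : C ∈ comap (stoneCechUnit : Z → StoneCech Z) (𝓝 (stoneCechUnit z)) := by
    rwa [← isEmbedding_stoneCechUnit.isInducing.nhds_eq_comap]
  obtain ⟨V, hV, hVC⟩ := hz'
  obtain ⟨V', hV', hVo, hzV⟩ := mem_nhds_iff.1 hV
  refine mem_of_superset (hVo.mem_nhds hzV) ?_
  have h1 : V' ⊆ closure (stoneCechUnit '' C) := by
    refine (denseRange_stoneCechUnit.open_subset_closure_inter hVo).trans (closure_mono ?_)
    rintro _ ⟨hx, ⟨x, rfl⟩⟩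
    exact ⟨x, hVC (hV' hx), rfl⟩
  rw [(hC.image continuous_stoneCechUnit).isClosed.closure_eq] at h1
  exact h1.trans (image_subset_range _ _)

theorem compactSpace_stoneCechRemainder [T2Space Z] [LocallyCompactSpace Z] :
    CompactSpace (StoneCechRemainder Z) :=
  isCompact_iff_compactSpace.1 (isOpen_range_stoneCechUnit (Z := Z)).isClosed_compl.isCompact

/-- The self-homeomorphism of `βZ` extending a self-homeomorphism of `Z`. -/
noncomputable def stoneCechHomeo (h : Z ≃ₜ Z) : StoneCech Z ≃ₜ StoneCech Z where
  toFun := stoneCechExtend (continuous_stoneCechUnit.comp h.continuous)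
  invFun := stoneCechExtend (continuous_stoneCechUnit.comp h.symm.continuous)
  left_inv := congrFun <| by
    refine stoneCech_hom_ext ((continuous_stoneCechExtend _).comp
      (continuous_stoneCechExtend _)) continuous_id ?_
    ext z
    simp
  right_inv := congrFun <| by
    refine stoneCech_hom_ext ((continuous_stoneCechExtend _).comp
      (continuous_stoneCechExtend _)) continuous_id ?_
    ext z
    simp
  continuous_toFun := continuous_stoneCechExtend _
  continuous_invFun := continuous_stoneCechExtend _

@[simp]
theorem stoneCechHomeo_unit (h : Z ≃ₜ Z) (z : Z) :
    stoneCechHomeo h (stoneCechUnit z) = stoneCechUnit (h z) :=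
  stoneCechExtend_stoneCechUnit (continuous_stoneCechUnit.comp h.continuous) z

/-- The self-homeomorphism of the remainder of `Z` induced by a self-homeomorphism of `Z`. -/
noncomputable def remainderHomeo (h : Z ≃ₜ Z) : StoneCechRemainder Z ≃ₜ StoneCechRemainder Z :=
  (stoneCechHomeo h).subtype fun p => by
    refine not_congr ⟨?_, ?_⟩
    · rintro ⟨z, rfl⟩
      exact ⟨h z, (stoneCechHomeo_unit h z).symm⟩
    · rintro ⟨z, hz⟩
      refine ⟨h.symm z, (stoneCechHomeo h).injective ?_⟩
      simpa using hz

theorem remainderHomeo_symm (h : Z ≃ₜ Z) : (remainderHomeo h).symm = remainderHomeo h.symm :=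
  rfl

theorem mem_closure_of_notMem_isCompact [T2Space Z] {C : Set Z}
    (hC : IsCompact C) (p : StoneCechRemainder Z) :
    (p : StoneCech Z) ∈ closure (stoneCechUnit '' Cᶜ) := by
  have h1 : (p : StoneCech Z) ∈ closure (stoneCechUnit '' C ∪ stoneCechUnit '' Cᶜ) := by
    rw [← image_union, union_compl_self, image_univ]
    exact denseRange_stoneCechUnit _
  rw [closure_union, (hC.image continuous_stoneCechUnit).isClosed.closure_eq] at h1
  refine h1.resolve_left fun h => p.2 (image_subset_range _ _ h)

/-- Each point of the remainder is in the closure of the complement of every compact set, so a bound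
off a compact set passes to it. -/
theorem eq_on_remainder_of_vanishing [T2Space Z] (G : C(StoneCech Z, ℝ)) (h h' : Z ≃ₜ Z)
    (hG : ∀ ε > 0, ∃ C : Set Z, IsCompact C ∧
      ∀ z ∉ C, |G (stoneCechUnit (h z)) - G (stoneCechUnit (h' z))| ≤ ε)
    (p : StoneCechRemainder Z) :
    G (remainderHomeo h p) = G (remainderHomeo h' p) := by
  rw [← sub_eq_zero, ← abs_nonpos_iff]
  refine le_of_forall_pos_le_add fun ε hε => ?_
  rw [zero_add]
  obtain ⟨C, hC, hCε⟩ := hG ε hε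
  have hcl : IsClosed {q | |G (stoneCechHomeo h q) - G (stoneCechHomeo h' q)| ≤ ε} :=
    isClosed_le (by fun_prop) continuous_const
  refine (closure_minimal ?_ hcl) (mem_closure_of_notMem_isCompact hC p)
  rintro _ ⟨z, hz, rfl⟩
  simpa using hCε z hz

theorem tendsto_remainderHomeo {x : ℕ → Z} {l : Filter ℕ} {p : StoneCechRemainder Z}
    (hp : Tendsto (fun k => stoneCechUnit (x k)) l (𝓝 (p : StoneCech Z)))
    (G : C(StoneCech Z, ℝ)) (h : Z ≃ₜ Z) :
    Tendsto (fun k => G (stoneCechUnit (h (x k)))) l (𝓝 (G (remainderHomeo h p))) := by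
  have h1 : Continuous fun q => G (stoneCechHomeo h q) := by fun_prop
  refine ((h1.tendsto _).comp hp).congr fun k => ?_
  simp

end StoneCechBasics

/-! ### Limits of nets of homeomorphisms that stabilise on every continuous function. -/

section LimitHomeo

variable {W : Type u} [TopologicalSpace W] [CompactSpace W] [T2Space W]

theorem continuous_of_forall_continuousMap_comp {V : Type v} [TopologicalSpace V] {φ : V → W}
    (h : ∀ G : C(W, ℝ), Continuous fun p => G (φ p)) : Continuous φ := by
  rw [continuous_iff_continuousAt]
  intro p
  rw [ContinuousAt, tendsto_nhds]
  intro U hU hpU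
  obtain ⟨f, hf, hfp, hfU⟩ := CompletelyRegularSpace.completely_regular_isOpen (φ p) U hU hpU
  have hc := h ⟨fun w => (f w : ℝ), continuous_subtype_val.comp hf⟩
  have : {q | ((f (φ q) : ℝ)) < 1} ∈ 𝓝 p :=
    (isOpen_lt hc continuous_const).mem_nhds (by simp [hfp])
  refine mem_of_superset this fun q hq => ?_
  by_contra hqU
  have := hfU hqU
  simp [this] at hq

theorem eq_of_forall_continuousMap_eq {p q : W} (h : ∀ G : C(W, ℝ), G p = G q) : p = q := by
  by_contra hne
  obtain ⟨f, hf, hfp, hfU⟩ := CompletelyRegularSpace.completely_regular_isOpen p {q}ᶜ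
    isOpen_compl_singleton hne
  have := h ⟨fun w => (f w : ℝ), continuous_subtype_val.comp hf⟩
  have h2 : f q = 1 := hfU (by simp)
  simp [hfp, h2] at this

theorem exists_limit_map {ι : Type v} [LinearOrder ι] [Nonempty ι] (h : ι → W → W)
    (hc : ∀ i, Continuous (h i))
    (hst : ∀ G : C(W, ℝ), ∃ i, ∀ j ≥ i, ∀ p, G (h j p) = G (h i p)) :
    ∃ φ : W → W, Continuous φ ∧ ∀ G : C(W, ℝ), ∃ i, ∀ j ≥ i, ∀ p, G (φ p) = G (h j p) := by
  have key : ∀ p, ∃ q, ∀ G : C(W, ℝ), ∀ i, (∀ j ≥ i, ∀ p, G (h j p) = G (h i p)) →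
      G q = G (h i p) := by
    intro p
    -- The limit of `h i p` along any ultrafilter finer than `atTop` serves: each `G` is eventually
    -- constant on the net, so its value at the limit is the stable one.
    let 𝒰 : Ultrafilter ι := Ultrafilter.of atTop
    obtain ⟨q, -, hq⟩ := isCompact_univ.ultrafilter_le_nhds (𝒰.map fun i => h i p) (by simp)
    refine ⟨q, fun G i hi => ?_⟩
    have h1 : Tendsto (fun j => G (h j p)) 𝒰 (𝓝 (G q)) :=
      (G.continuous.tendsto q).comp hq
    refine tendsto_nhds_unique h1 (tendsto_const_nhds.congr' ?_)
    have : ∀ᶠ j in (𝒰 : Filter ι), i ≤ j := Ultrafilter.of_le atTop (eventually_ge_atTop i)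
    filter_upwards [this] with j hj
    exact (hi j hj p).symm
  choose φ hφ using key
  have hφ' : ∀ G : C(W, ℝ), ∃ i, ∀ j ≥ i, ∀ p, G (φ p) = G (h j p) := by
    intro G
    obtain ⟨i, hi⟩ := hst G
    exact ⟨i, fun j hj p => (hφ p G i hi).trans (hi j hj p).symm⟩
  refine ⟨φ, continuous_of_forall_continuousMap_comp fun G => ?_, hφ'⟩
  obtain ⟨i, hi⟩ := hφ' G
  simp_rw [hi i le_rfl]
  exact G.continuous.comp (hc i)

theorem exists_limit_homeomorph {ι : Type v} [LinearOrder ι] [Nonempty ι] (h : ι → W ≃ₜ W)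
    (hst : ∀ G : C(W, ℝ), ∃ i, ∀ j ≥ i, ∀ p, G (h j p) = G (h i p))
    (hst' : ∀ G : C(W, ℝ), ∃ i, ∀ j ≥ i, ∀ p, G ((h j).symm p) = G ((h i).symm p)) :
    ∃ φ : W ≃ₜ W, ∀ G : C(W, ℝ), ∃ i, ∀ j ≥ i, ∀ p, G (φ p) = G (h j p) := by
  obtain ⟨φ, hφc, hφ⟩ := exists_limit_map (fun i => h i) (fun i => (h i).continuous) hst
  obtain ⟨ψ, hψc, hψ⟩ :=
    exists_limit_map (fun i => (h i).symm) (fun i => (h i).symm.continuous) hst'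
  have hl : ∀ p, ψ (φ p) = p := fun p => eq_of_forall_continuousMap_eq fun G => by
    -- Replace `ψ` by `(h i).symm` under `G`, then `φ` by `h k` under `G ∘ (h i).symm`; at `k ≥ i`
    -- the two indices can be made equal and the maps cancel.
    obtain ⟨i, hi⟩ := hψ G
    obtain ⟨j, hj⟩ := hφ (G.comp ⟨_, (h i).symm.continuous⟩)
    let k := max i j
    have h1 := hj k (le_max_right _ _) p
    simp only [ContinuousMap.comp_apply, ContinuousMap.coe_mk] at h1
    rw [hi i le_rfl, h1, ← hi i le_rfl, hi k (le_max_left _ _), Homeomorph.symm_apply_apply]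
  have hr : ∀ p, φ (ψ p) = p := fun p => eq_of_forall_continuousMap_eq fun G => by
    obtain ⟨i, hi⟩ := hφ G
    obtain ⟨j, hj⟩ := hψ (G.comp ⟨_, (h i).continuous⟩)
    let k := max i j
    have h1 := hj k (le_max_right _ _) p
    simp only [ContinuousMap.comp_apply, ContinuousMap.coe_mk] at h1
    rw [hi i le_rfl, h1, ← hi i le_rfl, hi k (le_max_left _ _), Homeomorph.apply_symm_apply]
  exact ⟨⟨⟨φ, ψ, hl, hr⟩, hφc, hψc⟩, hφ⟩

end LimitHomeo

/-! ### The scale in `ℕ → ℝ` and the binary tree of sequences. -/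

section Tower

/-- The limit step of the tree: enumerate `ι` by `a`, and at coordinate `k` follow the sequence of
index `m (N k)`, the largest of the first `N k + 1` indices, where `N k` tends to infinity slowly
enough for all errors so far to be below `1 / (N k + 1)`. -/
theorem exists_diagonal {ι M : Type*} [LinearOrder ι] [Countable ι] [PseudoMetricSpace M]
    [Nonempty M] (f : ι → ℕ → ℝ) (t : ι → ℕ → M)
    (h : ∀ i j, j < i → Tendsto (fun k => dist (t i k) (t j k) * f j k) atTop (𝓝 0)) :
    ∃ τ : ℕ → M, ∀ j, Tendsto (fun k => dist (τ k) (t j k) * |f j k|) atTop (𝓝 0) := by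
  classical
  rcases isEmpty_or_nonempty ι with hι | hι
  · exact ⟨fun _ => Classical.arbitrary M, fun j => (hι.false j).elim⟩
  obtain ⟨a, ha⟩ := exists_surjective_nat ι
  let m : ℕ → ι := fun n => partialSups a n
  have hm : ∀ n' n, n' ≤ n → a n' ≤ m n := fun n' n hn => le_partialSups_of_le a hn
  let P : ℕ → ℕ → Prop := fun k n =>
    ∀ n' ≤ n, dist (t (m n) k) (t (a n') k) * |f (a n') k| ≤ 1 / ((n : ℝ) + 1)
  -- `m 0 = a 0` makes the distance zero, so `Nat.findGreatest` always returns an index satisfying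
  -- `P k`.
  have hP0 : ∀ k, P k 0 := by
    intro k n' hn'
    obtain rfl : n' = 0 := by omega
    simp [m]
  have hP : ∀ n, ∀ᶠ k in atTop, P k n := by
    intro n
    have : ∀ n' ∈ Set.Iic n, ∀ᶠ k in atTop,
        dist (t (m n) k) (t (a n') k) * |f (a n') k| ≤ 1 / ((n : ℝ) + 1) := by
      intro n' hn'
      rcases (hm n' n hn').eq_or_lt with he | hlt
      · refine Eventually.of_forall fun k => ?_
        rw [he, dist_self, zero_mul]
        positivity
      · have h1 := (h _ _ hlt).abs
        simp only [abs_mul, abs_dist, abs_zero] at h1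
        exact h1.eventually_le_const (by positivity)
    exact (eventually_all_finite (Set.finite_Iic n)).2 this
  let N : ℕ → ℕ := fun k => Nat.findGreatest (P k) k
  have hN : ∀ k, P k (N k) := fun k => Nat.findGreatest_spec (Nat.zero_le k) (hP0 k)
  have hNt : Tendsto N atTop atTop := by
    rw [tendsto_atTop]
    intro n
    filter_upwards [hP n, eventually_ge_atTop n] with k hk hnk
    exact Nat.le_findGreatest hnk hk
  refine ⟨fun k => t (m (N k)) k, fun j => ?_⟩
  obtain ⟨n, rfl⟩ := ha j
  have h1 : Tendsto (fun k => 1 / ((N k : ℝ) + 1)) atTop (𝓝 0) :=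
    tendsto_one_div_add_atTop_nhds_zero_nat.comp hNt
  refine tendsto_of_tendsto_of_tendsto_of_le_of_le' tendsto_const_nhds h1
    (Eventually.of_forall fun k => by positivity) ?_
  filter_upwards [hNt.eventually_ge_atTop n] with k hk
  exact hN k n hk

theorem exists_dominating_sequence {ι : Type*} [Countable ι] (f : ι → ℕ → ℝ) (e : ℕ → ℝ) :
    ∃ g : ℕ → ℝ, (∀ k, 2 ≤ g k) ∧ (∀ k, e k ≤ g k) ∧
      ∀ j, Tendsto (fun k => f j k / g k) atTop (𝓝 0) := by
  rcases isEmpty_or_nonempty ι with hι | hι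
  · exact ⟨fun k => max 2 (e k), fun k => le_max_left _ _, fun k => le_max_right _ _,
      fun j => (hι.false j).elim⟩
  obtain ⟨a, ha⟩ := exists_surjective_nat ι
  have hs : ∀ k : ℕ, 0 ≤ (k : ℝ) * ∑ n ∈ Finset.range (k + 1), |f (a n) k| := fun k =>
    mul_nonneg (Nat.cast_nonneg k) (Finset.sum_nonneg fun _ _ => abs_nonneg _)
  -- From `k = n` on, the sum contains `|f (a n) k|`, and the factor `k` turns domination into
  -- little-o.
  let g : ℕ → ℝ := fun (k : ℕ) => max 2 (e k) + (k : ℝ) * ∑ n ∈ Finset.range (k + 1), |f (a n) k|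
  have hg2 : ∀ k, 2 ≤ g k := fun k => by
    have := le_max_left 2 (e k)
    have := hs k
    simp only [g]
    linarith
  refine ⟨g, hg2, fun k => ?_, fun j => ?_⟩
  · have := le_max_right 2 (e k)
    have := hs k
    simp only [g]
    linarith
  · obtain ⟨n, rfl⟩ := ha j
    refine squeeze_zero_norm' ?_ tendsto_one_div_atTop_nhds_zero_nat
    filter_upwards [eventually_ge_atTop n, eventually_gt_atTop 0] with k hk hk0
    have hgk : 0 < g k := by linarith [hg2 k]
    have hk0' : (0 : ℝ) < k := Nat.cast_pos.2 hk0
    rw [Real.norm_eq_abs, abs_div, abs_of_pos hgk, div_le_div_iff₀ hgk hk0', one_mul]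
    have h1 : |f (a n) k| ≤ ∑ n ∈ Finset.range (k + 1), |f (a n) k| :=
      Finset.single_le_sum (f := fun n => |f (a n) k|) (fun _ _ => abs_nonneg _)
        (Finset.mem_range.2 (by omega))
    have h2 := le_max_left 2 (e k)
    have h3 := mul_le_mul_of_nonneg_left h1 hk0'.le
    simp only [g]
    linarith

variable {ι : Type*} [LinearOrder ι] [WellFoundedLT ι]

/-- Well-founded recursion on `exists_dominating_sequence`. Later `e` enumerates `ℕ → ℕ`, which
makes the scale dominate every modulus; the bound `2` keeps `1 / f i k` within the radius `1 / 2`.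
-/
theorem exists_scale (hι : ∀ i : ι, Countable (Iio i)) (e : ι → ℕ → ℝ) :
    ∃ f : ι → ℕ → ℝ, (∀ i k, 2 ≤ f i k) ∧ (∀ i k, e i k ≤ f i k) ∧
      ∀ i j, j < i → Tendsto (fun k => f j k / f i k) atTop (𝓝 0) := by
  have key : ∀ (i : ι) (F : Iio i → ℕ → ℝ), ∃ g : ℕ → ℝ, (∀ k, 2 ≤ g k) ∧ (∀ k, e i k ≤ g k) ∧
      ∀ j, Tendsto (fun k => F j k / g k) atTop (𝓝 0) := fun i F =>
    have := hι i
    exists_dominating_sequence F (e i)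
  choose step h1 h2 h3 using key
  let f : ι → ℕ → ℝ := wellFounded_lt.fix fun i F => step i fun j => F j j.2
  have hf : ∀ i, f i = step i fun j => f j := fun i => wellFounded_lt.fix_eq _ i
  refine ⟨f, fun i k => ?_, fun i k => ?_, fun i j hj => ?_⟩
  · rw [hf]; exact h1 _ _ _
  · rw [hf]; exact h2 _ _ _
  · rw [hf i]; exact h3 i (fun j => f j) ⟨j, hj⟩

theorem exists_tower {M : Type*} [PseudoMetricSpace M] [Nonempty M]
    (hM : ∀ (x : M) (δ : ℝ), 0 ≤ δ → δ ≤ 1 / 2 → ∃ y, dist x y = δ)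
    (hι : ∀ i : ι, Countable (Iio i)) (f : ι → ℕ → ℝ) (hf2 : ∀ i k, 2 ≤ f i k)
    (hf : ∀ i j, j < i → Tendsto (fun k => f j k / f i k) atTop (𝓝 0)) :
    ∃ t : (ι → Bool) → ι → ℕ → M,
      (∀ b i j, j < i → Tendsto (fun k => dist (t b i k) (t b j k) * f j k) atTop (𝓝 0)) ∧
      ∀ b b', b ≠ b' → ∃ i, ∀ k, dist (t b i k) (t b' i k) = 1 / f i k := by
  classical
  have hfpos : ∀ i k, 0 < f i k := fun i k => by linarith [hf2 i k]
  have hsh : ∀ i (τ : ℕ → M), ∃ τ' : ℕ → M, ∀ k, dist (τ k) (τ' k) = 1 / f i k := by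
    intro i τ
    have : ∀ k, ∃ y, dist (τ k) y = 1 / f i k := fun k =>
      hM _ _ (one_div_nonneg.2 (hfpos i k).le)
        (one_div_le_one_div_of_le two_pos (hf2 i k))
    choose τ' h using this
    exact ⟨τ', h⟩
  choose sh hsh using hsh
  -- Coherence of `T` is a premise of the conclusion, so that `lim` is total and the recursion can
  -- be written before coherence of the tree is known.
  have key : ∀ (i : ι) (T : Iio i → ℕ → M), ∃ τ : ℕ → M,
      (∀ i' j : Iio i, j < i' →
        Tendsto (fun k => dist (T i' k) (T j k) * f j k) atTop (𝓝 0)) →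
      ∀ j, Tendsto (fun k => dist (τ k) (T j k) * f j k) atTop (𝓝 0) := by
    intro i T
    by_cases h : ∀ i' j : Iio i, j < i' →
        Tendsto (fun k => dist (T i' k) (T j k) * f j k) atTop (𝓝 0)
    · have := hι i
      obtain ⟨τ, hτ⟩ := exists_diagonal (fun j : Iio i => f j) T h
      refine ⟨τ, fun _ j => ?_⟩
      simpa only [abs_of_pos (hfpos _ _)] using hτ j
    · exact ⟨fun _ => Classical.arbitrary M, fun h' => (h h').elim⟩
  choose lim hlim using key
  let t : (ι → Bool) → ι → ℕ → M := fun b => wellFounded_lt.fix fun i T =>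
    if b i then sh i (lim i fun j => T j j.2) else lim i fun j => T j j.2
  have ht : ∀ b i, t b i = if b i then sh i (lim i fun j => t b j) else lim i fun j => t b j :=
    fun b i => wellFounded_lt.fix_eq _ i
  refine ⟨t, fun b i => ?_, fun b b' hbb' => ?_⟩
  · induction i using WellFoundedLT.induction with
    | ind i ih =>
      intro j hj
      have h1 := hlim i (fun j => t b j) (fun i' j' hj' => ih i' i'.2 j' hj') ⟨j, hj⟩
      rw [ht b i]
      split_ifs with hb
      · have h2 := (hf i j hj).add h1
        rw [add_zero] at h2
        refine squeeze_zero (fun k => mul_nonneg dist_nonneg (hfpos j k).le) (fun k => ?_) h2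
        have h3 := dist_triangle_left (sh i (lim i fun j => t b j) k) (t b j k)
          (lim i (fun j => t b j) k)
        rw [hsh] at h3
        calc _ ≤ (1 / f i k + dist (lim i (fun j => t b j) k) (t b j k)) * f j k :=
              mul_le_mul_of_nonneg_right h3 (hfpos j k).le
          _ = _ := by ring
      · exact h1
  -- Below the first disagreement the branches coincide, so at `i` both start from the same `lim`
  -- and exactly one of them is shifted by `1 / f i`.
  · obtain ⟨i, hi, hmin⟩ := wellFounded_lt.has_min {i | b i ≠ b' i} (Function.ne_iff.1 hbb')
    have hlt : ∀ j < i, b j = b' j := fun j hj => by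
      by_contra h
      exact hmin j h hj
    have hagree : ∀ j < i, t b j = t b' j := by
      intro j
      induction j using WellFoundedLT.induction with
      | ind j ih =>
        intro hj
        have : (fun l : Iio j => t b l) = fun l : Iio j => t b' l :=
          funext fun l => ih l l.2 (lt_trans l.2 hj)
        rw [ht b, ht b', this, hlt j hj]
    have h0 : (fun l : Iio i => t b l) = fun l : Iio i => t b' l :=
      funext fun l => hagree l l.2
    refine ⟨i, fun k => ?_⟩
    have hne : b i ≠ b' i := hi
    rw [ht b, ht b', h0]
    rcases Bool.eq_false_or_eq_true (b i) with h | h <;>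
      rcases Bool.eq_false_or_eq_true (b' i) with h' | h'
    · exact absurd (h.trans h'.symm) hne
    · simp [h, h', dist_comm _ (lim i _ k), hsh]
    · simp [h, h', hsh]
    · exact absurd (h.trans h'.symm) hne

end Tower

/-! ### Homeomorphisms of a normed space moving the origin inside the unit ball. -/

section Bump

variable {E : Type*} [NormedAddCommGroup E] [NormedSpace ℝ E]

/-- The perturbation of the identity that pushes points of the unit ball in direction `w`. -/
noncomputable def bumpMap (w x : E) : E := x + max 0 (1 - ‖x‖) • w

theorem bumpMap_of_one_le_norm (w : E) {x : E} (hx : 1 ≤ ‖x‖) : bumpMap w x = x := by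
  simp [bumpMap, max_eq_left (sub_nonpos.2 hx)]

@[simp]
theorem bumpMap_zero (w : E) : bumpMap w 0 = w := by
  simp [bumpMap]

theorem norm_bumpMap_le {w x : E} (hw : ‖w‖ ≤ 1 / 2) (hx : ‖x‖ ≤ 1) : ‖bumpMap w x‖ ≤ 1 := by
  have h0 : 0 ≤ 1 - ‖x‖ := sub_nonneg.2 hx
  calc ‖bumpMap w x‖ ≤ ‖x‖ + ‖max 0 (1 - ‖x‖) • w‖ := norm_add_le _ _
    _ = ‖x‖ + (1 - ‖x‖) * ‖w‖ := by
      rw [max_eq_right h0, norm_smul, Real.norm_of_nonneg h0]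
    _ ≤ 1 := by nlinarith [norm_nonneg w]

theorem abs_bump_sub_le {F : Type*} [NormedAddCommGroup F] (x x' : F) : |max 0 (1 - ‖x‖) - max 0 (1 - ‖x'‖)| ≤ ‖x - x'‖ := by
  rw [max_comm 0 (1 - ‖x‖), max_comm 0 (1 - ‖x'‖)]
  refine (abs_max_sub_max_le_abs _ _ _).trans ?_
  rw [sub_sub_sub_cancel_left, norm_sub_rev]
  exact abs_norm_sub_norm_le _ _

theorem dist_bumpMap_le (w w' x : E) (hx : ‖x‖ ≤ 1) :
    dist (bumpMap w x) (bumpMap w' x) ≤ dist w w' := by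
  have h0 : 0 ≤ 1 - ‖x‖ := sub_nonneg.2 hx
  have h1 : 1 - ‖x‖ ≤ 1 := by linarith [norm_nonneg x]
  rw [bumpMap, bumpMap, dist_add_left, max_eq_right h0, dist_smul₀, Real.norm_of_nonneg h0]
  exact mul_le_of_le_one_left dist_nonneg h1

/-- The perturbation `x ↦ max 0 (1 - ‖x‖) • w` is Lipschitz with constant `‖w‖ ≤ 1 / 2 < 1`, which
makes `bumpMap w` invertible. -/
theorem approximatesLinearOn_bumpMap {w : E} (hw : ‖w‖ ≤ 1 / 2) :
    ApproximatesLinearOn (bumpMap w) (ContinuousLinearEquiv.refl ℝ E : E →L[ℝ] E) univ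
      (1 / 2) := by
  intro x _ x' _
  have : bumpMap w x - bumpMap w x' - (ContinuousLinearEquiv.refl ℝ E : E →L[ℝ] E) (x - x') =
      (max 0 (1 - ‖x‖) - max 0 (1 - ‖x'‖)) • w := by
    simp only [bumpMap, ContinuousLinearEquiv.coe_refl, ContinuousLinearMap.coe_id', id_eq,
      sub_smul]
    abel
  rw [this, norm_smul, Real.norm_eq_abs, mul_comm]
  exact mul_le_mul (by simpa using hw) (abs_bump_sub_le _ _) (abs_nonneg _) (by simp)

/-- From `x ≠ 0` move by `δ` along the line towards the origin, possibly past it: the new norm is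
`|‖x‖ - δ| ≤ 1 / 2`. -/
theorem exists_dist_eq_of_closedBall [Nontrivial E]
    (x : Metric.closedBall (0 : E) (1 / 2)) (δ : ℝ)
    (h0 : 0 ≤ δ) (h1 : δ ≤ 1 / 2) : ∃ y : Metric.closedBall (0 : E) (1 / 2), dist x y = δ := by
  obtain ⟨x, hx⟩ := x
  rw [mem_closedBall_zero_iff] at hx
  rcases eq_or_ne x 0 with rfl | hx0
  · obtain ⟨y, hy⟩ := exists_norm_eq E h0
    exact ⟨⟨y, by rwa [mem_closedBall_zero_iff, hy]⟩, by simp [Subtype.dist_eq, hy]⟩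
  · have hpos : 0 < ‖x‖ := norm_pos_iff.2 hx0
    refine ⟨⟨(1 - δ / ‖x‖) • x, ?_⟩, ?_⟩
    · rw [mem_closedBall_zero_iff, norm_smul, Real.norm_eq_abs, ← abs_of_pos hpos, ← abs_mul,
        abs_of_pos hpos, sub_mul, div_mul_cancel₀ _ hpos.ne', one_mul]
      exact abs_le.2 ⟨by linarith, by linarith⟩
    · rw [Subtype.dist_eq, dist_eq_norm]
      have : x - (1 - δ / ‖x‖) • x = (δ / ‖x‖) • x := by
        rw [sub_smul, one_smul, sub_sub_cancel]
      rw [this, norm_smul, Real.norm_of_nonneg (by positivity), div_mul_cancel₀ _ hpos.ne']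

variable [CompleteSpace E] [Nontrivial E]

/-- `bumpMap w` as a homeomorphism. -/
noncomputable def bumpHomeo (w : E) (hw : ‖w‖ ≤ 1 / 2) : E ≃ₜ E :=
  (approximatesLinearOn_bumpMap hw).toHomeomorph (bumpMap w) <| .inr <| by
    have : ‖((ContinuousLinearEquiv.refl ℝ E).symm : E →L[ℝ] E)‖₊ = 1 := by
      rw [← NNReal.coe_inj]
      simp
    rw [this, inv_one]
    exact one_half_lt_one

theorem bumpHomeo_apply (w : E) (hw : ‖w‖ ≤ 1 / 2) (x : E) : bumpHomeo w hw x = bumpMap w x :=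
  rfl

theorem norm_bumpHomeo_symm_le (w : E) (hw : ‖w‖ ≤ 1 / 2) {x : E} (hx : ‖x‖ ≤ 1) :
    ‖(bumpHomeo w hw).symm x‖ ≤ 1 := by
  by_contra! h
  have h1 := bumpMap_of_one_le_norm w h.le
  rw [← bumpHomeo_apply w hw, Homeomorph.apply_symm_apply] at h1
  rw [← h1] at h
  exact h.not_ge hx

/-- With `a`, `a'` the two preimages, `‖a - a'‖ ≤ dist w w' + ‖a - a'‖ / 2`; hence the factor `2`.
-/
theorem dist_bumpHomeo_symm_le (w w' : E) (hw : ‖w‖ ≤ 1 / 2) (hw' : ‖w'‖ ≤ 1 / 2) {x : E}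
    (hx : ‖x‖ ≤ 1) :
    dist ((bumpHomeo w hw).symm x) ((bumpHomeo w' hw').symm x) ≤ 2 * dist w w' := by
  set a := (bumpHomeo w hw).symm x with ha
  set a' := (bumpHomeo w' hw').symm x with ha'
  have h1 : bumpMap w a = bumpMap w' a' := by
    rw [← bumpHomeo_apply w hw, ← bumpHomeo_apply w' hw', ha, ha', Homeomorph.apply_symm_apply,
      Homeomorph.apply_symm_apply]
  have h2 : a - a' = (bumpMap w' a' - bumpMap w a') +
      -(max 0 (1 - ‖a‖) - max 0 (1 - ‖a'‖)) • w := by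
    have h3 := h1
    simp only [bumpMap] at h3 ⊢
    rw [← h3]
    simp only [neg_smul, sub_smul]
    abel
  have h4 := dist_bumpMap_le w' w a' (norm_bumpHomeo_symm_le w' hw' hx)
  have h5 : ‖-(max 0 (1 - ‖a‖) - max 0 (1 - ‖a'‖)) • w‖ ≤ ‖a - a'‖ * (1 / 2) := by
    rw [norm_smul, norm_neg, Real.norm_eq_abs]
    exact mul_le_mul (abs_bump_sub_le _ _) hw (norm_nonneg _) (norm_nonneg _)
  have h6 := norm_add_le (bumpMap w' a' - bumpMap w a')
    (-(max 0 (1 - ‖a‖) - max 0 (1 - ‖a'‖)) • w)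
  rw [← h2] at h6
  rw [dist_eq_norm] at h4 ⊢
  rw [dist_comm] at h4
  linarith

end Bump

/-! ### Extending homeomorphisms of an open subspace by the identity. -/

section Extension

variable {U Z : Type*} {J : U → Z} {S : Set U}

theorem extend_of_notMem_image (hJ : Function.Injective J) {q : U → U}
    (hq : ∀ u ∉ S, q u = u) {z : Z} (hz : z ∉ J '' S) :
    Function.extend J (J ∘ q) id z = z := by
  by_cases hz' : z ∈ range J
  · obtain ⟨u, rfl⟩ := hz'
    rw [hJ.extend_apply, Function.comp_apply, hq u fun h => hz (mem_image_of_mem J h)]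
  · rw [Function.extend_apply' _ _ _ hz', id]

theorem extend_extend_cancel (hJ : Function.Injective J) {q r : U → U}
    (h : ∀ u, q (r u) = u) (z : Z) :
    Function.extend J (J ∘ q) id (Function.extend J (J ∘ r) id z) = z := by
  by_cases hz : z ∈ range J
  · obtain ⟨u, rfl⟩ := hz
    rw [hJ.extend_apply, Function.comp_apply, hJ.extend_apply, Function.comp_apply, h]
  · rw [Function.extend_apply' _ _ z hz, id, Function.extend_apply' _ _ _ hz, id]
variable {V : Type*} [TopologicalSpace U] [TopologicalSpace Z] [TopologicalSpace V]

theorem continuous_of_comp_isOpenEmbedding (hJ : IsOpenEmbedding J) (hS : IsClosed (J '' S))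
    {F F₀ : Z → V} (h : Continuous (F ∘ J)) (h₀ : Continuous F₀)
    (hF : ∀ z ∉ J '' S, F z = F₀ z) : Continuous F := by
  rw [continuous_iff_continuousAt]
  intro z
  by_cases hz : z ∈ range J
  · obtain ⟨u, rfl⟩ := hz
    exact hJ.continuousAt_iff.1 h.continuousAt
  · have : (J '' S)ᶜ ∈ 𝓝 z := hS.isOpen_compl.mem_nhds fun h => hz (image_subset_range _ _ h)
    exact h₀.continuousAt.congr (mem_of_superset this fun z hz => (hF z hz).symm)

theorem continuous_extend_comp (hJ : IsOpenEmbedding J) (hS : IsClosed (J '' S)) {q : U → U}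
    (hq : ∀ u ∉ S, q u = u) (hc : Continuous q) :
    Continuous (Function.extend J (J ∘ q) id) := by
  refine continuous_of_comp_isOpenEmbedding hJ hS ?_ continuous_id
    fun z hz => extend_of_notMem_image hJ.injective hq hz
  have : Function.extend J (J ∘ q) id ∘ J = J ∘ q :=
    funext fun u => hJ.injective.extend_apply _ _ _
  rw [this]
  exact hJ.continuous.comp hc

theorem symm_apply_of_notMem {h : U ≃ₜ U} (hh : ∀ u ∉ S, h u = u) :
    ∀ u ∉ S, h.symm u = u := fun u hu => by
  rw [Homeomorph.symm_apply_eq, hh u hu]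

/-- Extension by the identity of a homeomorphism of an open subspace that is supported in a set
closed in the whole space. -/
noncomputable def extendHomeo (hJ : IsOpenEmbedding J) (hS : IsClosed (J '' S)) (h : U ≃ₜ U)
    (hh : ∀ u ∉ S, h u = u) : Z ≃ₜ Z where
  toFun := Function.extend J (J ∘ h) id
  invFun := Function.extend J (J ∘ h.symm) id
  left_inv := extend_extend_cancel hJ.injective h.symm_apply_apply
  right_inv := extend_extend_cancel hJ.injective h.apply_symm_apply
  continuous_toFun := continuous_extend_comp hJ hS hh h.continuous
  continuous_invFun := continuous_extend_comp hJ hS (symm_apply_of_notMem hh) h.symm.continuous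

theorem extendHomeo_apply (hJ : IsOpenEmbedding J) (hS : IsClosed (J '' S)) (h : U ≃ₜ U)
    (hh : ∀ u ∉ S, h u = u) (u : U) : extendHomeo hJ hS h hh (J u) = J (h u) :=
  hJ.injective.extend_apply _ _ _

theorem extendHomeo_symm_apply (hJ : IsOpenEmbedding J) (hS : IsClosed (J '' S)) (h : U ≃ₜ U)
    (hh : ∀ u ∉ S, h u = u) (u : U) : (extendHomeo hJ hS h hh).symm (J u) = J (h.symm u) :=
  hJ.injective.extend_apply _ _ _

theorem extendHomeo_of_notMem (hJ : IsOpenEmbedding J) (hS : IsClosed (J '' S)) (h : U ≃ₜ U)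
    (hh : ∀ u ∉ S, h u = u) {z : Z} (hz : z ∉ J '' S) : extendHomeo hJ hS h hh z = z :=
  extend_of_notMem_image hJ.injective hh hz

theorem extendHomeo_symm_of_notMem (hJ : IsOpenEmbedding J) (hS : IsClosed (J '' S)) (h : U ≃ₜ U)
    (hh : ∀ u ∉ S, h u = u) {z : Z} (hz : z ∉ J '' S) : (extendHomeo hJ hS h hh).symm z = z :=
  extend_of_notMem_image hJ.injective (symm_apply_of_notMem hh) hz

end Extension

/-! ### Moduli of continuity on the balls and equality on the remainder. -/

section Estimate

variable {E K : Type*} [NormedAddCommGroup E] [TopologicalSpace K]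

/-- The union of the closed unit balls inside `ℕ × E × K`. -/
def unitBalls (E K : Type*) [NormedAddCommGroup E] : Set (ℕ × E × K) := {u | ‖u.2.1‖ ≤ 1}

/-- Apply a sequence of homeomorphisms of `E` levelwise on `ℕ × E × K`. -/
def levelHomeo (K : Type*) [TopologicalSpace K] (ρ : ℕ → E ≃ₜ E) : (ℕ × E × K) ≃ₜ (ℕ × E × K) where
  toFun u := (u.1, ρ u.1 u.2.1, u.2.2)
  invFun u := (u.1, (ρ u.1).symm u.2.1, u.2.2)
  left_inv u := by simp
  right_inv u := by simp
  continuous_toFun := by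
    rw [continuous_prod_of_discrete_left]
    intro k
    exact continuous_const.prodMk (((ρ k).continuous.comp continuous_fst).prodMk continuous_snd)
  continuous_invFun := by
    rw [continuous_prod_of_discrete_left]
    intro k
    exact continuous_const.prodMk
      (((ρ k).symm.continuous.comp continuous_fst).prodMk continuous_snd)

/-- Uniformity in `y` comes from currying: `x ↦ g (x, ·)` is continuous into `C(K, ℝ)` with the sup
metric, hence uniformly continuous on the compact unit ball. -/
theorem exists_uniform_modulus [ProperSpace E] [CompactSpace K] {g : E × K → ℝ}
    (hg : Continuous g) {ε : ℝ} (hε : 0 < ε) :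
    ∃ δ > 0, ∀ x x' y, ‖x‖ ≤ 1 → ‖x'‖ ≤ 1 → dist x x' < δ → |g (x, y) - g (x', y)| ≤ ε := by
  let c : C(E, C(K, ℝ)) := (ContinuousMap.mk g hg).curry
  have h1 : UniformContinuousOn c (Metric.closedBall 0 1) :=
    (isCompact_closedBall (0 : E) 1).uniformContinuousOn_of_continuous c.continuous.continuousOn
  obtain ⟨δ, hδ, h⟩ := Metric.uniformContinuousOn_iff_le.1 h1 ε hε
  refine ⟨δ, hδ, fun x x' y hx hx' hd => ?_⟩
  have h2 := h x (by simpa using hx) x' (by simpa using hx') hd.le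
  exact (ContinuousMap.dist_apply_le_dist y).trans h2

variable {Z : Type u} [TopologicalSpace Z] {J : ℕ × E × K → Z}

theorem exists_moduli [ProperSpace E] [CompactSpace K] (hJ : Continuous J)
    (G : C(StoneCech Z, ℝ)) :
    ∃ δ : ℕ → ℝ, (∀ k, 0 < δ k) ∧ ∀ k x x' y, ‖x‖ ≤ 1 → ‖x'‖ ≤ 1 → dist x x' < δ k →
      |G (stoneCechUnit (J (k, x, y))) - G (stoneCechUnit (J (k, x', y)))| ≤ 1 / ((k : ℝ) + 1) := by
  have h : ∀ k : ℕ, ∃ δ > 0, ∀ x x' y, ‖x‖ ≤ 1 → ‖x'‖ ≤ 1 → dist x x' < δ →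
      |G (stoneCechUnit (J (k, x, y))) - G (stoneCechUnit (J (k, x', y)))| ≤ 1 / ((k : ℝ) + 1) :=
    fun k => exists_uniform_modulus (g := fun xy => G (stoneCechUnit (J (k, xy))))
      (G.continuous.comp (continuous_stoneCechUnit.comp (hJ.comp (by fun_prop)))) (by positivity)
  choose δ h1 h2 using h
  exact ⟨δ, h1, h2⟩

/-- Off the balls both maps are the identity; on the `k`-th ball, for large `k`, the values of `G`
differ by at most `1 / (k + 1)`; the finitely many remaining balls form a compact set. -/
theorem remainderHomeo_congr_of_modulus [T2Space Z] [ProperSpace E] [CompactSpace K]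
    (hJ : Continuous J) (G : C(StoneCech Z, ℝ)) {δ : ℕ → ℝ}
    (hδ : ∀ k x x' y, ‖x‖ ≤ 1 → ‖x'‖ ≤ 1 → dist x x' < δ k →
      |G (stoneCechUnit (J (k, x, y))) - G (stoneCechUnit (J (k, x', y)))| ≤ 1 / ((k : ℝ) + 1))
    (h h' : Z ≃ₜ Z) (q q' : ℕ → E → E)
    (hq : ∀ k x y, h (J (k, x, y)) = J (k, q k x, y))
    (hq' : ∀ k x y, h' (J (k, x, y)) = J (k, q' k x, y))
    (hid : ∀ z ∉ J '' unitBalls E K, h z = z) (hid' : ∀ z ∉ J '' unitBalls E K, h' z = z)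
    (hb : ∀ k x, ‖x‖ ≤ 1 → ‖q k x‖ ≤ 1) (hb' : ∀ k x, ‖x‖ ≤ 1 → ‖q' k x‖ ≤ 1)
    (hclose : ∀ᶠ k in atTop, ∀ x, ‖x‖ ≤ 1 → dist (q k x) (q' k x) < δ k)
    (p : StoneCechRemainder Z) : G (remainderHomeo h p) = G (remainderHomeo h' p) := by
  refine eq_on_remainder_of_vanishing G h h' (fun ε hε => ?_) p
  have h1 := (tendsto_one_div_add_atTop_nhds_zero_nat (𝕜 := ℝ)).eventually_le_const hε
  obtain ⟨N, hN⟩ := eventually_atTop.1 (hclose.and h1)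
  refine ⟨J '' (Iio N ×ˢ (Metric.closedBall 0 1 ×ˢ univ)), ?_, fun z hz => ?_⟩
  · exact ((finite_Iio N).isCompact.prod
      ((isCompact_closedBall 0 1).prod isCompact_univ)).image hJ
  · by_cases hzS : z ∈ J '' unitBalls E K
    · obtain ⟨⟨k, x, y⟩, hx, rfl⟩ := hzS
      have hx1 : ‖x‖ ≤ 1 := hx
      have hk : N ≤ k := by
        by_contra! hk
        exact hz (mem_image_of_mem J ⟨hk, by simpa using hx1, trivial⟩)
      rw [hq, hq']
      exact (hδ k _ _ y (hb k x hx1) (hb' k x hx1) ((hN k hk).1 x hx1)).trans (hN k hk).2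
    · rw [hid z hzS, hid' z hzS, sub_self, abs_zero]
      exact hε.le

end Estimate

/-! ### Twists along a branch and their limit on the remainder. -/

section TowerHomeos

variable {E K : Type*} [NormedAddCommGroup E] [NormedSpace ℝ E] [ProperSpace E] [Nontrivial E]
  [TopologicalSpace K] {Z : Type u} [TopologicalSpace Z] {J : ℕ × E × K → Z}

theorem levelHomeo_bumpHomeo_of_notMem (τ : ℕ → Metric.closedBall (0 : E) (1 / 2)) :
    ∀ u ∉ unitBalls E K, levelHomeo K
      (fun k => bumpHomeo (τ k : E) (mem_closedBall_zero_iff.1 (τ k).2)) u = u := by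
  rintro ⟨k, x, y⟩ hu
  have hx : 1 ≤ ‖x‖ := (not_le.1 hu).le
  simp [levelHomeo, bumpHomeo_apply, bumpMap_of_one_le_norm _ hx]

/-- The homeomorphism of `Z` that acts on the `k`-th ball by the bump map with vector `τ k`. -/
noncomputable def twist (hJ : IsOpenEmbedding J) (hS : IsClosed (J '' unitBalls E K))
    (τ : ℕ → Metric.closedBall (0 : E) (1 / 2)) : Z ≃ₜ Z :=
  extendHomeo hJ hS (levelHomeo K
    (fun k => bumpHomeo (τ k : E) (mem_closedBall_zero_iff.1 (τ k).2)))
    (levelHomeo_bumpHomeo_of_notMem τ)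

variable (hJ : IsOpenEmbedding J) (hS : IsClosed (J '' unitBalls E K))

theorem twist_apply (τ : ℕ → Metric.closedBall (0 : E) (1 / 2)) (k : ℕ) (x : E) (y : K) :
    twist hJ hS τ (J (k, x, y)) = J (k, bumpMap (τ k : E) x, y) :=
  extendHomeo_apply hJ hS _ _ _

theorem twist_symm_apply (τ : ℕ → Metric.closedBall (0 : E) (1 / 2)) (k : ℕ) (x : E) (y : K) :
    (twist hJ hS τ).symm (J (k, x, y)) =
      J (k, (bumpHomeo (τ k : E) (mem_closedBall_zero_iff.1 (τ k).2)).symm x, y) :=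
  extendHomeo_symm_apply hJ hS _ _ _

theorem exists_index_twist_stable [T2Space Z] [CompactSpace K] {ι : Type*} [LinearOrder ι]
    {e : ι → ℕ → ℕ} (he : Function.Surjective e) {f : ι → ℕ → ℝ} (hf2 : ∀ i k, 2 ≤ f i k)
    (hfe : ∀ i k, (e i k : ℝ) ≤ f i k) {t : ι → ℕ → Metric.closedBall (0 : E) (1 / 2)}
    (ht : ∀ i j, j < i → Tendsto (fun k => dist (t i k) (t j k) * f j k) atTop (𝓝 0))
    (G : C(StoneCech Z, ℝ)) :
    ∃ i, ∀ j ≥ i, ∀ p,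
      G (remainderHomeo (twist hJ hS (t j)) p) = G (remainderHomeo (twist hJ hS (t i)) p) ∧
      G (remainderHomeo (twist hJ hS (t j)).symm p) =
        G (remainderHomeo (twist hJ hS (t i)).symm p) := by
  obtain ⟨δ, hδ0, hδ⟩ := exists_moduli hJ.continuous G
  -- The `2` is the Lipschitz constant in `dist_bumpHomeo_symm_le`, so that one index serves the
  -- twists and their inverses.
  obtain ⟨i, hi⟩ := he fun k => ⌈2 / δ k⌉₊
  refine ⟨i, fun j hj => ?_⟩
  rcases hj.eq_or_lt with rfl | hlt
  · exact fun p => ⟨rfl, rfl⟩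
  have hclose : ∀ᶠ k in atTop, 2 * dist (t j k) (t i k) < δ k := by
    filter_upwards [(ht j i hlt).eventually_lt_const one_pos] with k hk
    have h1 : 2 / δ k ≤ f i k := by
      refine le_trans ?_ (hfe i k)
      rw [hi]
      exact Nat.le_ceil _
    rw [div_le_iff₀ (hδ0 k)] at h1
    have h2 : 0 < f i k := by linarith [hf2 i k]
    nlinarith
  have hdist : ∀ k, dist (t j k) (t i k) ≤ 2 * dist (t j k) (t i k) := fun k => by
    linarith [dist_nonneg (x := t j k) (y := t i k)]
  have hn : ∀ (i : ι) k, ‖(t i k : E)‖ ≤ 1 / 2 := fun i k => mem_closedBall_zero_iff.1 (t i k).2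
  refine fun p => ⟨?_, ?_⟩
  · refine remainderHomeo_congr_of_modulus hJ.continuous G hδ _ _ _ _
      (twist_apply hJ hS (t j)) (twist_apply hJ hS (t i))
      (fun z hz => extendHomeo_of_notMem hJ hS _ _ hz)
      (fun z hz => extendHomeo_of_notMem hJ hS _ _ hz)
      (fun k x hx => norm_bumpMap_le (hn j k) hx) (fun k x hx => norm_bumpMap_le (hn i k) hx) ?_ p
    filter_upwards [hclose] with k hk x hx
    exact ((dist_bumpMap_le _ _ x hx).trans (hdist k)).trans_lt hk
  · refine remainderHomeo_congr_of_modulus hJ.continuous G hδ _ _ _ _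
      (twist_symm_apply hJ hS (t j)) (twist_symm_apply hJ hS (t i))
      (fun z hz => extendHomeo_symm_of_notMem hJ hS _ _ hz)
      (fun z hz => extendHomeo_symm_of_notMem hJ hS _ _ hz)
      (fun k x hx => norm_bumpHomeo_symm_le _ (hn j k) hx)
      (fun k x hx => norm_bumpHomeo_symm_le _ (hn i k) hx) ?_ p
    filter_upwards [hclose] with k hk x hx
    exact (dist_bumpHomeo_symm_le _ _ _ _ hx).trans_lt hk

theorem exists_limit_twist [T2Space Z] [LocallyCompactSpace Z] [CompactSpace K] {ι : Type*}
    [LinearOrder ι] [Nonempty ι]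
    {e : ι → ℕ → ℕ} (he : Function.Surjective e) {f : ι → ℕ → ℝ} (hf2 : ∀ i k, 2 ≤ f i k)
    (hfe : ∀ i k, (e i k : ℝ) ≤ f i k) {t : ι → ℕ → Metric.closedBall (0 : E) (1 / 2)}
    (ht : ∀ i j, j < i → Tendsto (fun k => dist (t i k) (t j k) * f j k) atTop (𝓝 0)) :
    ∃ φ : StoneCechRemainder Z ≃ₜ StoneCechRemainder Z, ∀ G : C(StoneCech Z, ℝ),
      ∃ i, ∀ j ≥ i, ∀ p, G (φ p) = G (remainderHomeo (twist hJ hS (t j)) p) := by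
  have := compactSpace_stoneCechRemainder (Z := Z)
  have hcl : IsClosed ((range (stoneCechUnit : Z → StoneCech Z))ᶜ) :=
    isOpen_range_stoneCechUnit.isClosed_compl
  -- Tietze extension from the closed remainder; the stability estimates concern functions on all of
  -- `βZ`.
  have key : ∀ G : C(StoneCechRemainder Z, ℝ), ∃ G' : C(StoneCech Z, ℝ), ∀ p, G p = G' p := by
    intro G
    obtain ⟨G', hG'⟩ := G.exists_restrict_eq hcl
    exact ⟨G', fun p => (DFunLike.congr_fun hG' p).symm⟩
  obtain ⟨φ, hφ⟩ := exists_limit_homeomorph (fun i => remainderHomeo (twist hJ hS (t i)))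
    (fun G => by
      obtain ⟨G', hG'⟩ := key G
      obtain ⟨i, hi⟩ := exists_index_twist_stable hJ hS he hf2 hfe ht G'
      exact ⟨i, fun j hj p => by rw [hG', hG', (hi j hj p).1]⟩)
    (fun G => by
      obtain ⟨G', hG'⟩ := key G
      obtain ⟨i, hi⟩ := exists_index_twist_stable hJ hS he hf2 hfe ht G'
      exact ⟨i, fun j hj p => by
        rw [remainderHomeo_symm, remainderHomeo_symm, hG', hG', (hi j hj p).2]⟩)
  exact ⟨φ, fun G => hφ (G.comp ⟨_, continuous_subtype_val⟩)⟩

end TowerHomeos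

/-! ### Distinguishing the limits of distinct branches. -/

section Separation

variable {E K : Type*} {Z : Type u} {J : ℕ × E × K → Z}

/-- The first two coordinates of a point in the range of `J`. -/
noncomputable def ballCoord (J : ℕ × E × K → Z) : Z → Option (ℕ × E) :=
  Function.extend J (fun u => some (u.1, u.2.1)) fun _ => none

theorem ballCoord_apply (hJ : Function.Injective J) (k : ℕ) (x : E) (y : K) :
    ballCoord J (J (k, x, y)) = some (k, x) :=
  hJ.extend_apply _ _ _

variable [NormedAddCommGroup E] [TopologicalSpace K] [TopologicalSpace Z]

/-- A limit of the centres inside `Z` would lie in the closed union of balls, hence in some open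
level `m`, which contains only one of the centres. -/
theorem exists_remainder_limit [T2Space Z] [LocallyCompactSpace Z] (hJ : IsOpenEmbedding J)
    (hS : IsClosed (J '' unitBalls E K)) (y₀ : K) :
    ∃ p : StoneCechRemainder Z,
      Tendsto (fun k => stoneCechUnit (J (k, 0, y₀))) (hyperfilter ℕ) (𝓝 (p : StoneCech Z)) := by
  have := t35Space_of_locallyCompactSpace (Z := Z)
  obtain ⟨q, -, hq⟩ := isCompact_univ.ultrafilter_le_nhds
    ((hyperfilter ℕ).map fun k => stoneCechUnit (J (k, 0, y₀))) (by simp)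
  have hq' : Tendsto (fun k => stoneCechUnit (J (k, 0, y₀))) (hyperfilter ℕ) (𝓝 q) := hq
  refine ⟨⟨q, ?_⟩, hq'⟩
  rintro ⟨z, rfl⟩
  have hz : Tendsto (fun k => J (k, 0, y₀)) (hyperfilter ℕ) (𝓝 z) :=
    isEmbedding_stoneCechUnit.isInducing.tendsto_nhds_iff.2 hq'
  have hzS : z ∈ J '' unitBalls E K := hS.mem_of_tendsto hz <| Eventually.of_forall fun k =>
    mem_image_of_mem J (by simp [unitBalls])
  obtain ⟨⟨m, x, y⟩, -, rfl⟩ := hzS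
  have hnhd : J '' ({m} ×ˢ univ) ∈ 𝓝 (J (m, x, y)) :=
    (hJ.isOpenMap _ ((isOpen_discrete _).prod isOpen_univ)).mem_nhds
      (mem_image_of_mem J ⟨rfl, trivial⟩)
  have hm : ∀ᶠ k in (hyperfilter ℕ : Filter ℕ), k = m := by
    filter_upwards [hz hnhd] with k hk
    obtain ⟨u, hu, huk⟩ := hk
    have := hJ.injective huk
    rw [this] at hu
    exact hu.1
  exact (finite_singleton m).notMem_hyperfilter hm

/-- The value at `(k, x)` of a bump of height one centred at `w k` with slope `r k`. -/
noncomputable def bumpValue (r : ℕ → ℝ) (w : ℕ → E) : Option (ℕ × E) → unitInterval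
  | none => 0
  | some (k, x) => projIcc 0 1 zero_le_one (1 - r k * dist x (w k))

theorem bumpValue_some (r : ℕ → ℝ) (w : ℕ → E) (k : ℕ) (x : E) :
    (bumpValue r w (some (k, x)) : ℝ) = max 0 (min 1 (1 - r k * dist x (w k))) := by
  rw [bumpValue, coe_projIcc]

theorem continuous_bumpValue (hJ : IsOpenEmbedding J) (hS : IsClosed (J '' unitBalls E K))
    {r : ℕ → ℝ} (hr : ∀ k, 2 ≤ r k) {w : ℕ → E} (hw : ∀ k, ‖w k‖ ≤ 1 / 2) :
    Continuous fun z => bumpValue r w (ballCoord J z) := by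
  refine continuous_of_comp_isOpenEmbedding hJ hS (F₀ := fun _ => 0) ?_ continuous_const ?_
  · rw [continuous_prod_of_discrete_left]
    rintro k
    have : ∀ xy : E × K, bumpValue r w (ballCoord J (J (k, xy))) =
        projIcc 0 1 zero_le_one (1 - r k * dist xy.1 (w k)) := fun xy => by
      rw [show (k, xy) = (k, xy.1, xy.2) from rfl, ballCoord_apply hJ.injective, bumpValue]
    simp only [Function.comp_apply, this]
    exact continuous_projIcc.comp (by fun_prop)
  · intro z hz
    by_cases hz' : z ∈ range J
    · obtain ⟨⟨k, x, y⟩, rfl⟩ := hz'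
      have hx : 1 < ‖x‖ := by
        by_contra! hx
        exact hz (mem_image_of_mem J hx)
      rw [ballCoord_apply hJ.injective, bumpValue, projIcc_of_le_left]
      · rfl
      -- Outside the unit ball the distance to `w k` exceeds `1 / 2`, and slope at least `2` brings
      -- the bump down to zero.
      · have h1 : ‖x‖ - ‖w k‖ ≤ dist x (w k) := by
          rw [dist_eq_norm]
          exact norm_sub_norm_le _ _
        nlinarith [hr k, hw k]
    · rw [ballCoord, Function.extend_apply' _ _ _ hz', bumpValue]

theorem exists_continuousMap_bumpValue (hJ : IsOpenEmbedding J)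
    (hS : IsClosed (J '' unitBalls E K))
    {r : ℕ → ℝ} (hr : ∀ k, 2 ≤ r k) {w : ℕ → E} (hw : ∀ k, ‖w k‖ ≤ 1 / 2) :
    ∃ G : C(StoneCech Z, ℝ), ∀ z, G (stoneCechUnit z) = bumpValue r w (ballCoord J z) :=
  have hc := continuous_bumpValue hJ hS hr hw
  ⟨⟨fun q => (stoneCechExtend hc q : unitInterval),
    continuous_subtype_val.comp (continuous_stoneCechExtend _)⟩, fun z =>
      congrArg Subtype.val (stoneCechExtend_stoneCechUnit hc z)⟩

variable [NormedSpace ℝ E] [ProperSpace E] [Nontrivial E]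

/-- The bump of slope `f i` centred at `t i k` tends to `1` along `t j` and to `0` along `t' j` for
`j ≥ i`, since both branches move only by `o(1 / f i)` after level `i`. That `G` depends on
`ballCoord` alone is what the coding of trivial homeomorphisms requires. -/
theorem exists_separating (hJ : IsOpenEmbedding J) (hS : IsClosed (J '' unitBalls E K))
    {ι : Type*} [LinearOrder ι] {f : ι → ℕ → ℝ} (hf2 : ∀ i k, 2 ≤ f i k)
    {t t' : ι → ℕ → Metric.closedBall (0 : E) (1 / 2)}
    (ht : ∀ i j, j < i → Tendsto (fun k => dist (t i k) (t j k) * f j k) atTop (𝓝 0))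
    (ht' : ∀ i j, j < i → Tendsto (fun k => dist (t' i k) (t' j k) * f j k) atTop (𝓝 0))
    {i : ι} (hi : ∀ k, dist (t i k) (t' i k) = 1 / f i k)
    {φ φ' : StoneCechRemainder Z ≃ₜ StoneCechRemainder Z}
    (hφ : ∀ G : C(StoneCech Z, ℝ), ∃ i, ∀ j ≥ i, ∀ p,
      G (φ p) = G (remainderHomeo (twist hJ hS (t j)) p))
    (hφ' : ∀ G : C(StoneCech Z, ℝ), ∃ i, ∀ j ≥ i, ∀ p,
      G (φ' p) = G (remainderHomeo (twist hJ hS (t' j)) p))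
    {y₀ : K} {p : StoneCechRemainder Z}
    (hp : Tendsto (fun k => stoneCechUnit (J (k, 0, y₀))) (hyperfilter ℕ)
      (𝓝 (p : StoneCech Z))) :
    ∃ (G : C(StoneCech Z, ℝ)) (g : Option (ℕ × E) → ℝ),
      (∀ z, G (stoneCechUnit z) = g (ballCoord J z)) ∧ G (φ p) ≠ G (φ' p) := by
  obtain ⟨G, hG⟩ := exists_continuousMap_bumpValue hJ hS (hf2 i) (w := fun k => (t i k : E))
    fun k => mem_closedBall_zero_iff.1 (t i k).2
  refine ⟨G, fun o => bumpValue (f i) (fun k => (t i k : E)) o, hG, ?_⟩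
  have hpos : ∀ k, 0 < f i k := fun k => by linarith [hf2 i k]
  have hself : ∀ {s : ι → ℕ → Metric.closedBall (0 : E) (1 / 2)},
      (∀ i j, j < i → Tendsto (fun k => dist (s i k) (s j k) * f j k) atTop (𝓝 0)) →
      ∀ j ≥ i, Tendsto (fun k => f i k * dist (s j k) (s i k)) (hyperfilter ℕ) (𝓝 0) := by
    intro s hs j hj
    rcases hj.eq_or_lt with rfl | hlt
    · simp
    · exact ((hs j i hlt).congr fun k => mul_comm _ _).mono_left Nat.hyperfilter_le_atTop
  obtain ⟨i₁, hi₁⟩ := hφ G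
  obtain ⟨i₂, hi₂⟩ := hφ' G
  let j := max i (max i₁ i₂)
  have hj : i ≤ j := le_max_left _ _
  rw [hi₁ j ((le_max_left _ _).trans (le_max_right _ _)),
    hi₂ j ((le_max_right _ _).trans (le_max_right _ _))]
  have hval : ∀ (s : ι → ℕ → Metric.closedBall (0 : E) (1 / 2)) k,
      G (stoneCechUnit (twist hJ hS (s j) (J (k, 0, y₀)))) =
        max 0 (min 1 (1 - f i k * dist (s j k) (t i k))) := fun s k => by
    rw [twist_apply, bumpMap_zero, hG, ballCoord_apply hJ.injective, bumpValue_some,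
      Subtype.dist_eq]
  have h1 : G (remainderHomeo (twist hJ hS (t j)) p) = 1 := by
    refine tendsto_nhds_unique (tendsto_remainderHomeo hp G _) ?_
    refine Tendsto.congr (fun k => (hval t k).symm) ?_
    have := (tendsto_const_nhds (x := (0 : ℝ))).max
      ((tendsto_const_nhds (x := (1 : ℝ))).min
        ((tendsto_const_nhds (x := (1 : ℝ))).sub (hself ht j hj)))
    simpa using this
  have h2 : G (remainderHomeo (twist hJ hS (t' j)) p) = 0 := by
    refine tendsto_nhds_unique (tendsto_remainderHomeo hp G _) ?_
    refine Tendsto.congr (fun k => (hval t' k).symm) ?_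
    refine squeeze_zero (fun k => le_max_left _ _) (fun k => ?_) (hself ht' j hj)
    refine max_le (mul_nonneg (hpos k).le dist_nonneg) ((min_le_right _ _).trans ?_)
    have h3 := dist_triangle (t i k) (t' j k) (t' i k)
    rw [hi, div_le_iff₀ (hpos k), dist_comm (t i k)] at h3
    linarith
  rw [h1, h2]
  exact one_ne_zero

end Separation

/-! ### Coding trivial homeomorphisms by sequences. -/

section Trivial

variable {E K : Type*} {Z : Type u} [TopologicalSpace Z] {J : ℕ × E × K → Z}

/-- By continuity of `F` at `p`, `φ p` is the limit of the points `f (x k)`, so their ball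
coordinates determine the value at `φ p` of every function that factors through `ballCoord`. The
value `none` on `K₁` is harmless, as `p` is outside the closed image of `K₁`. -/
theorem exists_code_of_isTrivialRemainderHomeo [T2Space Z]
    {φ : StoneCechRemainder Z ≃ₜ StoneCechRemainder Z}
    (hφ : IsTrivialRemainderHomeo φ) {x : ℕ → Z} {l : Filter ℕ} {p : StoneCechRemainder Z}
    (hp : Tendsto (fun k => stoneCechUnit (x k)) l (𝓝 (p : StoneCech Z))) :
    ∃ D : ℕ → Option (ℕ × E), ∀ (G : C(StoneCech Z, ℝ)) (g : Option (ℕ × E) → ℝ),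
      (∀ z, G (stoneCechUnit z) = g (ballCoord J z)) →
      Tendsto (fun k => g (D k)) l (𝓝 (G (φ p))) := by
  classical
  obtain ⟨K₁, K₂, f, F, hK₁, -, hF, hFf, hFφ⟩ := hφ
  refine ⟨fun k => if h : x k ∈ K₁ᶜ then ballCoord J (f ⟨x k, h⟩ : Z) else none,
    fun G g hGg => ?_⟩
  have hopen : (stoneCechUnit '' K₁)ᶜ ∈ 𝓝 (p : StoneCech Z) :=
    (hK₁.image continuous_stoneCechUnit).isClosed.isOpen_compl.mem_nhds
      fun h => p.2 (image_subset_range _ _ h)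
  have h1 : Tendsto (fun k => G (F (stoneCechUnit (x k)))) l (𝓝 (G (φ p))) := by
    rw [← hFφ]
    exact (G.continuous.tendsto _).comp ((hF.continuousAt hopen).tendsto.comp hp)
  refine h1.congr' ?_
  filter_upwards [hp hopen] with k hk
  have hk' : x k ∈ K₁ᶜ := fun h => hk (mem_image_of_mem _ h)
  rw [dif_pos hk', ← hGg, ← hFf ⟨x k, hk'⟩]

end Trivial

/-! ### Lower and upper cardinality bounds. -/

section Counting

open Cardinal

/-- CH enters here: the order must be long enough to enumerate `ℕ → ℕ`, yet have countable initial
segments for the diagonal arguments. -/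
theorem exists_wellOrder_of_continuumHypothesis (hCH : continuum.{0} = aleph.{0} 1) :
    ∃ (ι : Type) (_ : LinearOrder ι) (_ : WellFoundedLT ι), (∀ i : ι, Countable (Iio i)) ∧
      #ι = continuum.{0} := by
  refine ⟨(aleph.{0} 1).ord.ToType, inferInstance, inferInstance, fun i => ?_, ?_⟩
  · have h : #(Iio i) < #(aleph.{0} 1).ord.ToType := mk_Iio_lt i (by simp)
    rw [mk_ord_toType, lt_aleph_one_iff] at h
    exact mk_le_aleph0_iff.1 h
  · rw [mk_ord_toType, hCH]

variable {Z : Type u} [TopologicalSpace Z]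

theorem le_mk_nontrivial_remainderHomeo [T2Space Z] [LocallyCompactSpace Z]
    {E : Type} {K : Type*} [NormedAddCommGroup E] [NormedSpace ℝ E] [ProperSpace E] [Nontrivial E]
    [TopologicalSpace K] [CompactSpace K] [Nonempty K]
    (hCH : continuum.{0} = aleph.{0} 1) (hE : #E ≤ continuum.{0})
    {J : ℕ × E × K → Z} (hJ : IsOpenEmbedding J) (hS : IsClosed (J '' unitBalls E K)) :
    2 ^ continuum.{u} ≤ #{φ : StoneCechRemainder Z ≃ₜ StoneCechRemainder Z //
      ¬ IsTrivialRemainderHomeo φ} := by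
  classical
  obtain ⟨ι, _, _, hι, hιc⟩ := exists_wellOrder_of_continuumHypothesis hCH
  have hιne : Nonempty ι := mk_ne_zero_iff.1 (hιc ▸ continuum_ne_zero)
  obtain ⟨e⟩ : Nonempty (ι ≃ (ℕ → ℕ)) := by
    rw [← Cardinal.eq, hιc]
    simp
  have hMne : Nonempty (Metric.closedBall (0 : E) (1 / 2)) := ⟨⟨0, by simp⟩⟩
  obtain ⟨f, hf2, hfe, hf⟩ := exists_scale hι fun i k => (e i k : ℝ)
  obtain ⟨t, ht, htne⟩ := exists_tower (M := Metric.closedBall (0 : E) (1 / 2))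
    exists_dist_eq_of_closedBall hι f hf2 hf
  choose φ hφ using fun b => exists_limit_twist hJ hS e.surjective hf2 hfe (ht b)
  let y₀ : K := Classical.arbitrary K
  obtain ⟨p, hp⟩ := exists_remainder_limit hJ hS y₀
  have hsep : ∀ b b', b ≠ b' → ∃ (G : C(StoneCech Z, ℝ)) (g : Option (ℕ × E) → ℝ),
      (∀ z, G (stoneCechUnit z) = g (ballCoord J z)) ∧ G (φ b p) ≠ G (φ b' p) := by
    intro b b' hbb'
    obtain ⟨i, hi⟩ := htne b b' hbb'
    exact exists_separating hJ hS hf2 (ht b) (ht b') hi (hφ b) (hφ b') hp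
  have hφinj : Function.Injective φ := by
    intro b b' h
    by_contra hne
    obtain ⟨G, g, -, hG⟩ := hsep b b' hne
    exact hG (by rw [h])
  let T : Set (ι → Bool) := {b | IsTrivialRemainderHomeo (φ b)}
  have hT : ∀ b : T, ∃ D : ℕ → Option (ℕ × E), ∀ (G : C(StoneCech Z, ℝ))
      (g : Option (ℕ × E) → ℝ), (∀ z, G (stoneCechUnit z) = g (ballCoord J z)) →
      Tendsto (fun k => g (D k)) (hyperfilter ℕ) (𝓝 (G (φ b p))) := fun b =>
    exists_code_of_isTrivialRemainderHomeo b.2 hp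
  choose D hD using hT
  have hDinj : Function.Injective D := by
    intro b b' h
    by_contra hne
    obtain ⟨G, g, hg, hG⟩ := hsep b b' fun h => hne (Subtype.ext h)
    refine hG (tendsto_nhds_unique (hD b G g hg) ?_)
    rw [h]
    exact hD b' G g hg
  -- The codes omit the coordinate in `K`, whose cardinality is not bounded.
  have hcode : #(ℕ → Option (ℕ × E)) ≤ continuum.{0} := by
    rw [← power_def, mk_nat, mk_option, mk_prod, mk_nat, lift_id, lift_id,
      ← continuum_power_aleph0]
    refine power_le_power_right ?_
    refine add_le_of_le aleph0_le_continuum ?_ (one_le_aleph0.trans aleph0_le_continuum)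
    exact mul_le_of_le aleph0_le_continuum aleph0_le_continuum hE
  have hB : #(ι → Bool) = 2 ^ continuum.{0} := by
    rw [← power_def, hιc, mk_bool]
  have hTlt : #T < #(ι → Bool) := by
    rw [hB]
    exact ((mk_le_of_injective hDinj).trans hcode).trans_lt (cantor _)
  have : Infinite (ι → Bool) := by
    rw [infinite_iff, hB]
    exact aleph0_le_continuum.trans (cantor _).le
  have hTc : #(Tᶜ : Set (ι → Bool)) = 2 ^ continuum.{0} := (mk_compl_of_infinite T hTlt).trans hB
  have hinj : Function.Injective fun b : (Tᶜ : Set (ι → Bool)) =>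
      (⟨φ b, b.2⟩ : {φ : StoneCechRemainder Z ≃ₜ StoneCechRemainder Z //
        ¬ IsTrivialRemainderHomeo φ}) := fun b b' h =>
    Subtype.ext (hφinj (congrArg Subtype.val h))
  have := lift_mk_le_lift_mk_of_injective hinj
  rw [hTc] at this
  simpa using this

theorem mk_continuousMap_stoneCech_le [SecondCountableTopology Z] :
    #C(StoneCech Z, ℝ) ≤ continuum.{u} := by
  rcases isEmpty_or_nonempty Z with hZ | hZ
  · have : IsEmpty (StoneCech Z) := by
      by_contra h
      rw [not_isEmpty_iff] at h
      exact not_nonempty_iff.2 hZ denseRange_stoneCechUnit.nonempty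
    have : Subsingleton C(StoneCech Z, ℝ) := ⟨fun f g => ContinuousMap.ext fun x => isEmptyElim x⟩
    exact (le_one_iff_subsingleton.2 this).trans (one_le_aleph0.trans aleph0_le_continuum)
  · obtain ⟨s, hs⟩ := TopologicalSpace.exists_dense_seq Z
    have hd : DenseRange fun n => (stoneCechUnit (s n) : StoneCech Z) :=
      denseRange_stoneCechUnit.comp hs continuous_stoneCechUnit
    have hinj : Function.Injective fun (G : C(StoneCech Z, ℝ)) (n : ℕ) =>
        G (stoneCechUnit (s n)) := fun G G' h =>
      DFunLike.coe_injective (hd.equalizer G.continuous G'.continuous h)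
    have := lift_mk_le_lift_mk_of_injective hinj
    rw [← power_def, mk_nat, mk_real, continuum_power_aleph0] at this
    simpa using this

/-- `R φ` records which cozero sets `φ` maps into which. Cozero sets form a base, so `R φ`
determines `φ`, and it is a subset of a set of size at most `𝔠`. -/
theorem mk_remainderHomeo_le [SecondCountableTopology Z] :
    #(StoneCechRemainder Z ≃ₜ StoneCechRemainder Z) ≤ 2 ^ continuum.{u} := by
  let R : (StoneCechRemainder Z ≃ₜ StoneCechRemainder Z) →
      Set (C(StoneCech Z, ℝ) × C(StoneCech Z, ℝ)) := fun φ =>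
    {FG | ∀ p : StoneCechRemainder Z, 0 < FG.2 (p : StoneCech Z) → 0 < FG.1 (φ p : StoneCech Z)}
  have hsep : ∀ (q : StoneCech Z) (U : Set (StoneCech Z)), IsOpen U → q ∈ U →
      ∃ G : C(StoneCech Z, ℝ), 0 < G q ∧ ∀ q', 0 < G q' → q' ∈ U := by
    intro q U hU hq
    obtain ⟨f, hf, hfq, hfU⟩ := CompletelyRegularSpace.completely_regular_isOpen q U hU hq
    refine ⟨⟨fun q' => 1 - (f q' : ℝ), by fun_prop⟩, by simp [hfq], fun q' hq' => ?_⟩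
    by_contra h
    have := hfU h
    simp [this] at hq'
  have hR : Function.Injective R := by
    intro φ φ' h
    by_contra hne
    obtain ⟨p, hp⟩ := DFunLike.ne_iff.1 hne
    obtain ⟨F, hF, hF'⟩ := hsep (φ p) {(φ' p : StoneCech Z)}ᶜ isOpen_compl_singleton
      (fun h => hp (Subtype.ext h))
    have hO : IsOpen {q : StoneCechRemainder Z | 0 < F (φ q)} :=
      isOpen_lt continuous_const (by fun_prop)
    obtain ⟨U, hU, hUO⟩ := isOpen_induced_iff.1 hO
    have hpU : (p : StoneCech Z) ∈ U := by
      have : p ∈ {q : StoneCechRemainder Z | 0 < F (φ q)} := hF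
      rwa [← hUO] at this
    obtain ⟨G, hG, hG'⟩ := hsep p U hU hpU
    have h1 : (F, G) ∈ R φ := fun q hq => by
      have : q ∈ (Subtype.val ⁻¹' U : Set (StoneCechRemainder Z)) := hG' q hq
      rwa [hUO] at this
    rw [h] at h1
    exact hF' _ (h1 p hG) rfl
  refine (mk_le_of_injective hR).trans ?_
  rw [mk_set, mk_prod, lift_id]
  refine power_le_power_left two_ne_zero ?_
  exact mul_le_of_le aleph0_le_continuum mk_continuousMap_stoneCech_le
    mk_continuousMap_stoneCech_le

end Counting

/-! ### Compact clopen sets and locally finite families of balls. -/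

section Geometry

/-- In a compact neighbourhood `L` of the component, components are intersections of clopen sets, so
by compactness some clopen `s` of `L` lies in `interior L`; such an `s` is open in `Y` as well. -/
theorem exists_isCompact_isClopen_of_isCompact_connectedComponent {Y : Type*} [TopologicalSpace Y]
    [T2Space Y] [LocallyCompactSpace Y] {y : Y} (hy : IsCompact (connectedComponent y)) :
    ∃ Q : Set Y, IsCompact Q ∧ IsClopen Q ∧ y ∈ Q := by
  obtain ⟨L, hL, hyL⟩ := exists_compact_superset hy
  have : CompactSpace L := isCompact_iff_compactSpace.1 hL
  let y' : L := ⟨y, interior_subset (hyL mem_connectedComponent)⟩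
  have hsub : connectedComponent y' ⊆ Subtype.val ⁻¹' interior L := by
    intro z hz
    refine hyL ?_
    have h1 : IsPreconnected (Subtype.val '' connectedComponent y') :=
      isPreconnected_connectedComponent.image _ continuous_subtype_val.continuousOn
    exact h1.subset_connectedComponent ⟨y', mem_connectedComponent, rfl⟩ ⟨z, hz, rfl⟩
  rw [connectedComponent_eq_iInter_isClopen] at hsub
  have hdir : Directed (· ⊇ ·) fun s : {s : Set L // IsClopen s ∧ y' ∈ s} => s.1 := by
    rintro ⟨s, hs, hys⟩ ⟨r, hr, hyr⟩
    exact ⟨⟨s ∩ r, hs.inter hr, hys, hyr⟩, inter_subset_left, inter_subset_right⟩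
  have : Nonempty {s : Set L // IsClopen s ∧ y' ∈ s} := ⟨⟨univ, isClopen_univ, trivial⟩⟩
  obtain ⟨⟨s, hs, hys⟩, hsL⟩ := exists_subset_nhds_of_isCompact' hdir
    (fun s => s.2.1.1.isCompact) (fun s => s.2.1.1)
    (fun z hz => (isOpen_interior.preimage continuous_subtype_val).mem_nhds (hsub hz))
  have hsc : IsCompact (Subtype.val '' s) := hs.1.isCompact.image continuous_subtype_val
  refine ⟨Subtype.val '' s, hsc, ⟨hsc.isClosed, ?_⟩, ⟨y', hys, rfl⟩⟩
  obtain ⟨U, hU, rfl⟩ := isOpen_induced_iff.1 hs.2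
  have : Subtype.val '' (Subtype.val ⁻¹' U : Set L) = U ∩ interior L := by
    ext z
    constructor
    · rintro ⟨z, hz, rfl⟩
      exact ⟨hz, hsL hz⟩
    · rintro ⟨hz, hzL⟩
      exact ⟨⟨z, interior_subset hzL⟩, hz, rfl⟩
  rw [this]
  exact hU.inter isOpen_interior

/-- The sets are shells of a compact exhaustion, along a subsequence chosen to make each shell
nonempty. -/
theorem exists_disjoint_open_sequence (X : Type*) [TopologicalSpace X] [T2Space X]
    [LocallyCompactSpace X] [SigmaCompactSpace X] [NoncompactSpace X] :
    ∃ O : ℕ → Set X, (∀ k, IsOpen (O k)) ∧ (∀ k, (O k).Nonempty) ∧ Pairwise (Function.onFun Disjoint O) ∧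
      LocallyFinite O := by
  let κ : CompactExhaustion X := default
  have hstep : ∀ m, ∃ m', m < m' ∧ (interior (κ m') \ κ m).Nonempty := by
    intro m
    obtain ⟨x, hx⟩ := (ne_univ_iff_exists_notMem _).1 (κ.isCompact m).ne_univ
    obtain ⟨j, hj⟩ := κ.exists_mem x
    have hj' : x ∈ interior (κ (max (j + 1) (m + 1))) :=
      interior_mono (κ.subset (le_max_left _ _)) (κ.subset_interior_succ j hj)
    exact ⟨_, lt_of_lt_of_le (Nat.lt_succ_self m) (le_max_right _ _), x, hj', hx⟩
  choose s hs hs' using hstep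
  let m : ℕ → ℕ := fun k => s^[k] 0
  have hm : ∀ k, m (k + 1) = s (m k) := fun k => Function.iterate_succ_apply' s k 0
  have hmono : StrictMono m := strictMono_nat_of_lt_succ fun k => by rw [hm]; exact hs _
  refine ⟨fun k => interior (κ (m (k + 1))) \ κ (m k),
    fun k => isOpen_interior.sdiff (κ.isCompact _).isClosed, fun k => by simpa only [hm] using hs' (m k),
    ?_, ?_⟩
  · have : ∀ j k, j < k → Disjoint (interior (κ (m (j + 1))) \ κ (m j))
        (interior (κ (m (k + 1))) \ κ (m k)) := fun j k hjk => by
      refine disjoint_left.2 fun x hx hx' => hx'.2 ?_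
      exact κ.subset (hmono.monotone hjk) (interior_subset hx.1)
    intro j k hjk
    rcases hjk.lt_or_gt with h | h
    · exact this j k h
    · exact (this k j h).symm
  · intro x
    obtain ⟨j, hj⟩ := κ.exists_mem x
    refine ⟨interior (κ (j + 1)), isOpen_interior.mem_nhds (κ.subset_interior_succ j hj),
      (finite_Iio (j + 1)).subset fun k hk => ?_⟩
    obtain ⟨z, hz, hz'⟩ := hk
    by_contra! h
    rw [mem_Iio, not_lt] at h
    exact hz.2 (κ.subset (h.trans (hmono.le_apply)) (interior_subset hz'))

theorem exists_isOpenEmbedding_range_subset {E X : Type*} [NormedAddCommGroup E] [NormedSpace ℝ E]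
    [TopologicalSpace X] [ChartedSpace E X] {O : Set X} (hO : IsOpen O) (hne : O.Nonempty) :
    ∃ j : E → X, IsOpenEmbedding j ∧ range j ⊆ O := by
  obtain ⟨x, hx⟩ := hne
  let c := (chartAt E x).restr O
  have hxc : x ∈ c.source := by
    rw [OpenPartialHomeomorph.restr_source, hO.interior_eq]
    exact ⟨mem_chart_source E x, hx⟩
  obtain ⟨r, hr, hrc⟩ := Metric.isOpen_iff.1 c.open_target _ (c.map_source hxc)
  -- `univBall` maps all of `E` homeomorphically onto a ball inside the chart's target.
  let b := (OpenPartialHomeomorph.univBall (c x) r).trans c.symm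
  have hb : b.source = univ := by
    rw [OpenPartialHomeomorph.trans_source, OpenPartialHomeomorph.univBall_source, univ_inter,
      eq_univ_iff_forall]
    intro v
    refine hrc ?_
    rw [← OpenPartialHomeomorph.univBall_target _ hr]
    exact OpenPartialHomeomorph.map_source _ (by simp)
  refine ⟨b, b.isOpenEmbedding hb, ?_⟩
  rintro _ ⟨v, rfl⟩
  have h1 : b v ∈ b.target := b.map_source (by rw [hb]; trivial)
  have h2 : b v ∈ c.source := h1.1
  rw [OpenPartialHomeomorph.restr_source, hO.interior_eq] at h2
  exact h2.2

theorem exists_isOpenEmbedding_balls (E X : Type*) [NormedAddCommGroup E] [NormedSpace ℝ E]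
    [ProperSpace E] [TopologicalSpace X] [ChartedSpace E X] [T2Space X]
    [LocallyCompactSpace X] [SigmaCompactSpace X] [NoncompactSpace X] :
    ∃ j : ℕ × E → X, IsOpenEmbedding j ∧ IsClosed (j '' {u | ‖u.2‖ ≤ 1}) := by
  obtain ⟨O, hO, hne, hdis, hfin⟩ := exists_disjoint_open_sequence X
  choose j hj hjO using fun k => exists_isOpenEmbedding_range_subset (E := E) (hO k) (hne k)
  refine ⟨fun u => j u.1 u.2, ?_, ?_⟩
  · refine .of_continuous_injective_isOpenMap ?_ ?_ ?_
    · exact continuous_prod_of_discrete_left.2 fun k => (hj k).continuous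
    · rintro ⟨k, x⟩ ⟨k', x'⟩ h
      have hk : k = k' := by
        by_contra hk
        refine disjoint_left.1 (hdis hk) (hjO k ⟨x, rfl⟩) ?_
        rw [show j k x = j k' x' from h]
        exact hjO k' ⟨x', rfl⟩
      subst hk
      exact congrArg (Prod.mk k) ((hj k).injective h)
    · intro U hU
      have : (fun u : ℕ × E => j u.1 u.2) '' U = ⋃ k, j k '' ((fun x => (k, x)) ⁻¹' U) := by
        ext z
        simp only [mem_image, mem_iUnion, Prod.exists, mem_preimage]
      rw [this]
      exact isOpen_iUnion fun k => (hj k).isOpenMap _ (hU.preimage (by fun_prop))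
  · have : (fun u : ℕ × E => j u.1 u.2) '' {u | ‖u.2‖ ≤ 1} =
        ⋃ k, j k '' Metric.closedBall 0 1 := by
      ext z
      simp only [mem_image, mem_iUnion, Prod.exists, mem_ofPred_eq, mem_closedBall_zero_iff]
    rw [this]
    refine LocallyFinite.isClosed_iUnion (hfin.subset fun k => ?_) fun k =>
      ((isCompact_closedBall 0 1).image (hj k).continuous).isClosed
    exact (image_subset_range _ _).trans (hjO k)

end Geometry

/-! ### Application to manifolds and products. -/

section Manifolds

open Cardinal

theorem mk_euclideanSpace_le (n : ℕ) : #(EuclideanSpace ℝ (Fin n)) ≤ continuum.{0} := by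
  rw [mk_congr (WithLp.equiv 2 (Fin n → ℝ)), ← power_def, mk_real, mk_fin]
  exact power_nat_le aleph0_le_continuum

variable {n : ℕ} {X : Type u} [TopologicalSpace X] [ChartedSpace (EuclideanSpace ℝ (Fin n)) X]
  [LocallyCompactSpace X] [NoncompactSpace X] [T2Space X] [SecondCountableTopology X]

theorem le_mk_nontrivial_remainderHomeo_manifold (hCH : continuum.{0} = aleph.{0} 1) (hn : 0 < n) :
    2 ^ continuum.{u} ≤ #{φ : StoneCechRemainder X ≃ₜ StoneCechRemainder X //
      ¬ IsTrivialRemainderHomeo φ} := by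
  have : Nonempty (Fin n) := ⟨⟨0, hn⟩⟩
  obtain ⟨j, hj, hjc⟩ := exists_isOpenEmbedding_balls (EuclideanSpace ℝ (Fin n)) X
  let a := (Homeomorph.refl ℕ).prodCongr (Homeomorph.prodPUnit (EuclideanSpace ℝ (Fin n)))
  refine le_mk_nontrivial_remainderHomeo (K := PUnit.{1}) hCH (mk_euclideanSpace_le n)
    (hj.comp a.isOpenEmbedding) ?_
  have : j ∘ a '' unitBalls (EuclideanSpace ℝ (Fin n)) PUnit.{1} = j '' {u | ‖u.2‖ ≤ 1} := by
    rw [image_comp]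
    congr 1
    ext u
    exact ⟨fun ⟨w, hw, h⟩ => h ▸ hw, fun hu => ⟨(u.1, u.2, PUnit.unit), hu, rfl⟩⟩
  rwa [this]

theorem le_mk_nontrivial_remainderHomeo_prod (hCH : continuum.{0} = aleph.{0} 1) (hn : 0 < n)
    {Y : Type v} [TopologicalSpace Y] [T2Space Y] [LocallyCompactSpace Y] {y : Y}
    (hy : IsCompact (connectedComponent y)) :
    2 ^ continuum.{max u v} ≤ #{φ : StoneCechRemainder (X × Y) ≃ₜ StoneCechRemainder (X × Y) //
      ¬ IsTrivialRemainderHomeo φ} := by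
  have : Nonempty (Fin n) := ⟨⟨0, hn⟩⟩
  obtain ⟨j, hj, hjc⟩ := exists_isOpenEmbedding_balls (EuclideanSpace ℝ (Fin n)) X
  obtain ⟨Q, hQ, hQc, hyQ⟩ := exists_isCompact_isClopen_of_isCompact_connectedComponent hy
  have : CompactSpace Q := isCompact_iff_compactSpace.1 hQ
  have : Nonempty Q := ⟨⟨y, hyQ⟩⟩
  let a := (Homeomorph.prodAssoc ℕ (EuclideanSpace ℝ (Fin n)) Q).symm
  refine le_mk_nontrivial_remainderHomeo (K := Q) hCH (mk_euclideanSpace_le n)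
    ((hj.prodMap hQc.isOpen.isOpenEmbedding_subtypeVal).comp a.isOpenEmbedding) ?_
  -- `Q` is used as a clopen set twice: openness makes the inclusion an open embedding, closedness
  -- makes this product closed.
  have : Prod.map j Subtype.val ∘ a '' unitBalls (EuclideanSpace ℝ (Fin n)) Q =
      (j '' {u | ‖u.2‖ ≤ 1}) ×ˢ Q := by
    ext ⟨x, z⟩
    constructor
    · rintro ⟨⟨k, w, q⟩, hw, h⟩
      obtain ⟨rfl, rfl⟩ := Prod.ext_iff.1 h
      exact ⟨⟨(k, w), hw, rfl⟩, q.2⟩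
    · rintro ⟨⟨⟨k, w⟩, hw, rfl⟩, hz⟩
      exact ⟨(k, w, ⟨z, hz⟩), hw, rfl⟩
  rw [this]
  exact hjc.prod hQc.isClosed

theorem mk_remainderHomeo_eq {Z : Type u} [TopologicalSpace Z] [SecondCountableTopology Z]
    (h : 2 ^ continuum.{u} ≤ #{φ : StoneCechRemainder Z ≃ₜ StoneCechRemainder Z //
      ¬ IsTrivialRemainderHomeo φ}) :
    #{φ : StoneCechRemainder Z ≃ₜ StoneCechRemainder Z // ¬ IsTrivialRemainderHomeo φ} =
        2 ^ continuum.{u} ∧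
      #(StoneCechRemainder Z ≃ₜ StoneCechRemainder Z) = 2 ^ continuum.{u} :=
  ⟨((mk_subtype_le _).trans mk_remainderHomeo_le).antisymm h,
    mk_remainderHomeo_le.antisymm (h.trans (mk_subtype_le _))⟩

end Manifolds

end StoneCechRemainders

theorem mainTheorem3
    (hCH : Cardinal.continuum.{0} = Cardinal.aleph.{0} 1)
    (n : ℕ) (hn : 0 < n)
    (X : Type u) [TopologicalSpace X] [ChartedSpace (EuclideanSpace ℝ (Fin n)) X]
    [LocallyCompactSpace X] [NoncompactSpace X]
    [TopologicalSpace.MetrizableSpace X] [SecondCountableTopology X] :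
    (Cardinal.mk {φ : StoneCechRemainder X ≃ₜ StoneCechRemainder X //
          ¬ IsTrivialRemainderHomeo φ} = 2 ^ Cardinal.continuum.{u} ∧
      Cardinal.mk (StoneCechRemainder X ≃ₜ StoneCechRemainder X) =
          2 ^ Cardinal.continuum.{u}) ∧
    ∀ (Y : Type v) [TopologicalSpace Y] [T2Space Y] [LocallyCompactSpace Y],
      (∃ y : Y, IsCompact (connectedComponent y)) →
        2 ^ Cardinal.continuum.{max u v} ≤
          Cardinal.mk {φ : StoneCechRemainder (X × Y) ≃ₜ StoneCechRemainder (X × Y) //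
            ¬ IsTrivialRemainderHomeo φ} ∧
        (SecondCountableTopology Y →
          Cardinal.mk {φ : StoneCechRemainder (X × Y) ≃ₜ StoneCechRemainder (X × Y) //
              ¬ IsTrivialRemainderHomeo φ} = 2 ^ Cardinal.continuum.{max u v} ∧
          Cardinal.mk (StoneCechRemainder (X × Y) ≃ₜ StoneCechRemainder (X × Y)) =
              2 ^ Cardinal.continuum.{max u v}) := by
  refine ⟨mk_remainderHomeo_eq (le_mk_nontrivial_remainderHomeo_manifold hCH hn), ?_⟩
  rintro Y _ _ _ ⟨y, hy⟩
  have h := le_mk_nontrivial_remainderHomeo_prod (X := X) hCH hn hy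
  exact ⟨h, fun _ => mk_remainderHomeo_eq h⟩
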